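/- Let $(X,\mathcal{B},\mu)$ be a probability space and let $T\colon X\to X$ be an invertible measure preserving transformation (a bijection with $T$ and $T^{-1}$ measurable) that is totally ergodic, that is, $T^k$ is ergodic for every nonzero integer $k$. Let $m\ge 1$ and let $p\colon\mathbb{Z}^m\to\mathbb{Z}$ be a non-constant integral polynomial on $\mathbb{Z}^m$, that is, a non-constant map given by a polynomial in $m$ variables with rational coefficients that takes integer values on $\mathbb{Z}^m$. Then for every $A\in\mathcal{B}$ and every Følner sequence $(\Phi_N)$ of finite subsets of $\mathbb{Z}^m$, $$\lim_{N\to\infty}\frac{1}{|\Phi_N|}\sum_{n\in\Phi_N}\mu\bigl(A\cap T^{-p(n)}A\bigr)=\mu(A)^2 ,$$ where $T^{-p(n)}A=\{x\in X: T^{p(n)}x\in A\}$. In other words, the uniform Cesàro limit $\operatorname{UC-lim}_n\mu(A\cap T^{-p(n)}A)$ exists and equals $\mu(A)^2$. Here a sequence $(\Phi_N)$ of finite, eventually non-empty subsets of $\mathbb{Z}^m$ is Følner if $|(g+\Phi_N)\mathbin{\triangle}\Phi_N|/|\Phi_N|\to 0$ for every $g\in\mathbb{Z}^m$. -/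

import Mathlib

open Filter Topology MeasureTheory

/-- An integral polynomial on `ℤ^m`, viewed as a map `ℤ^m → ℤ`: it is given by a polynomial in `m`
variables with rational coefficients (whose values on `ℤ^m` are thus integers). -/
def IsIntegralPolynomial {m : ℕ} (p : (Fin m → ℤ) → ℤ) : Prop :=
  ∃ P : MvPolynomial (Fin m) ℚ,
    ∀ n : Fin m → ℤ, MvPolynomial.eval (fun i => (n i : ℚ)) P = (p n : ℚ)

/-- A Følner sequence of finite subsets of `ℤ^m`, for the action of `ℤ^m` on itself by
translations and the counting measure. -/
def IsFoelnerSeq {m : ℕ} (Φ : ℕ → Finset (Fin m → ℤ)) : Prop :=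
  IsAddFoelner (Fin m → ℤ) (Measure.count : Measure (Fin m → ℤ)) atTop
    (fun N => (Φ N : Set (Fin m → ℤ)))

/-- `HasUCLim a L` says that `UC-lim_n a_n` exists and equals `L`: along every Følner sequence in
`ℤ^m`, the averages of `a` converge to `L`. -/
def HasUCLim {m : ℕ} (a : (Fin m → ℤ) → ℝ) (L : ℝ) : Prop :=
  ∀ Φ : ℕ → Finset (Fin m → ℤ), IsFoelnerSeq Φ →
    Tendsto (fun N => (1 / ((Φ N).card : ℝ)) * ∑ n ∈ Φ N, a n) atTop (𝓝 L)

/-- The integer power `T ^ k` of an invertible measurable transformation `T`, formed in the group of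
permutations of `X`; for `k < 0` it is the power `|k|` of the inverse of `T`. -/
def zpowMap {X : Type*} [MeasurableSpace X] (T : X ≃ᵐ X) (k : ℤ) : X → X :=
  ⇑((T.toEquiv : Equiv.Perm X) ^ k)

/-- The invertible transformation `T` is totally ergodic: `T ^ k` is measure preserving and ergodic
for every nonzero integer `k` (the case `k = 1` says that `T` itself preserves `μ`). -/
def IsTotallyErgodic {X : Type*} [MeasurableSpace X] (T : X ≃ᵐ X) (μ : Measure X) : Prop :=
  ∀ k : ℤ, k ≠ 0 → Ergodic (zpowMap T k) μ

/-!
The theorem follows from a norm statement about the Koopman operators `U k g = g ∘ T ^ k` on real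
`L²(μ)`: if `f` is orthogonal to the constants, then the averages of `U (p n) f` along any Følner
sequence tend to zero. Applying this to `f = 1_A - μ(A)` and taking inner products with `1_A` gives
the limit `μ(A)²`.

The norm statement (`tendsto_finsetAvg_of_tendsto_cesaro`) needs no spectral theory. The degree of
`p` is measured by iterated finite differences (`FwdDiffDegreeLE`), and the proof is by induction on
it. If `p` has a non-constant difference in some direction `e`, van der Corput's lemma in that
direction (`IsFoelnerSeq.tendsto_finsetAvg_zero_of_correlation`) leaves correlations of the form
`⟪U (q n) f, f⟫`, where `q` is a translate of a difference of `p` with step `j • e`, `j ≠ 0`. Such a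
`q` has smaller degree and is again non-constant, because a function of finite degree with period
`j • e` already has period `e` (`FwdDiffDegreeLE.fwdDiff_eq_zero_of_zsmul`). If all differences of
`p` are constant, then `p` is affine with some nonzero slope `k`, and von Neumann's mean ergodic
theorem for `T ^ k` applies; this is where total ergodicity enters.
-/

/-! ### Finite-difference degree -/

/-- `p` has finite-difference degree at most `d`: every `(d + 1)`-fold iterated forward difference
of `p`, with arbitrary steps, vanishes. -/
def FwdDiffDegreeLE {G A : Type*} [AddCommGroup G] [AddCommGroup A] : ℕ → (G → A) → Prop
  | 0, p => ∀ h, fwdDiff h p = 0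
  | d + 1, p => ∀ h, FwdDiffDegreeLE d (fwdDiff h p)

section FwdDiff

variable {G A : Type*} [AddCommGroup G] [AddCommGroup A]

theorem fwdDiff_fwdDiff_comm (g h : G) (p : G → A) :
    fwdDiff g (fwdDiff h p) = fwdDiff h (fwdDiff g p) := by
  funext n
  simp only [fwdDiff, add_right_comm n g h]
  abel

namespace FwdDiffDegreeLE

theorem zero (d : ℕ) : FwdDiffDegreeLE d (0 : G → A) := by
  induction d with
  | zero => intro h; funext n; simp [fwdDiff]
  | succ d ih =>
    intro h
    have : fwdDiff h (0 : G → A) = 0 := by funext n; simp [fwdDiff]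
    rwa [this]

theorem succ {d : ℕ} {p : G → A} (hp : FwdDiffDegreeLE d p) : FwdDiffDegreeLE (d + 1) p := by
  induction d generalizing p with
  | zero => intro h; rw [hp h]; exact zero 0
  | succ d ih => exact fun h => ih (hp h)

theorem mono {d e : ℕ} (hde : d ≤ e) {p : G → A} (hp : FwdDiffDegreeLE d p) :
    FwdDiffDegreeLE e p := by
  induction e, hde using Nat.le_induction with
  | base => exact hp
  | succ e _ ih => exact ih.succ

theorem add {d : ℕ} {p q : G → A} (hp : FwdDiffDegreeLE d p) (hq : FwdDiffDegreeLE d q) :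
    FwdDiffDegreeLE d (p + q) := by
  induction d generalizing p q with
  | zero => intro h; rw [fwdDiff_add, hp h, hq h, add_zero]
  | succ d ih => intro h; rw [fwdDiff_add]; exact ih (hp h) (hq h)

theorem shift {d : ℕ} {p : G → A} (hp : FwdDiffDegreeLE d p) (g : G) :
    FwdDiffDegreeLE d (fun n => p (n + g)) := by
  have key : ∀ (p : G → A) (h : G),
      fwdDiff h (fun n => p (n + g)) = fun n => fwdDiff h p (n + g) := by
    intro p h; funext n; simp only [fwdDiff, add_right_comm n h g]
  induction d generalizing p with
  | zero => intro h; rw [key, hp h]; rfl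
  | succ d ih => intro h; rw [key]; exact ih (hp h)

theorem const_mul {R : Type*} [CommRing R] {d : ℕ} {p : G → R} (hp : FwdDiffDegreeLE d p) (c : R) :
    FwdDiffDegreeLE d (fun n => c * p n) := by
  have key : ∀ (p : G → R) (h : G),
      fwdDiff h (fun n => c * p n) = fun n => c * fwdDiff h p n := by
    intro p h; funext n; simp only [fwdDiff, mul_sub]
  induction d generalizing p with
  | zero => intro h; rw [key, hp h]; funext n; simp
  | succ d ih => intro h; rw [key]; exact ih (hp h)

theorem mul_addMonoidHom {R : Type*} [CommRing R] {d : ℕ} {p : G → R}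
    (hp : FwdDiffDegreeLE d p) (φ : G →+ R) : FwdDiffDegreeLE (d + 1) (fun n => p n * φ n) := by
  have key : ∀ (p : G → R) (h : G), fwdDiff h (fun n => p n * φ n) =
      (fun n => fwdDiff h p n * φ n) + fun n => φ h * p (n + h) := by
    intro p h; funext n; simp only [fwdDiff, Pi.add_apply, map_add]; ring
  induction d generalizing p with
  | zero =>
    intro h
    rw [key, hp h]
    refine add ?_ ((hp.shift h).const_mul _)
    simp only [Pi.zero_apply, zero_mul]
    exact zero 0
  | succ d ih =>
    intro h
    rw [key]
    exact (ih (hp h)).add ((hp.shift h).const_mul _)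

theorem of_comp_injective {B : Type*} [AddCommGroup B] (φ : A →+ B) (hφ : Function.Injective φ)
    {d : ℕ} {p : G → A} (hp : FwdDiffDegreeLE d (fun n => φ (p n))) : FwdDiffDegreeLE d p := by
  have key : ∀ (p : G → A) (h : G),
      fwdDiff h (fun n => φ (p n)) = fun n => φ (fwdDiff h p n) := by
    intro p h; funext n; simp only [fwdDiff, map_sub]
  induction d generalizing p with
  | zero =>
    intro h
    funext n
    have := congrFun (hp h) n
    rw [key] at this
    exact hφ (by simpa using this)
  | succ d ih =>
    intro h
    have := hp h
    rw [key] at this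
    exact ih this

/-- A function of finite degree which is periodic with period a nonzero multiple `j • e` is already
periodic with period `e`. By induction on the degree `fwdDiff e p` is periodic with period `e`, so
`p` is affine along `e`, and the slope is zero. -/
theorem fwdDiff_eq_zero_of_zsmul [IsAddTorsionFree A] {d : ℕ} {p : G → A}
    (hp : FwdDiffDegreeLE d p) {e : G} {j : ℤ} (hj : j ≠ 0) (h : fwdDiff (j • e) p = 0) :
    fwdDiff e p = 0 := by
  induction d generalizing p with
  | zero => exact hp e
  | succ d ih =>
    have h1 : fwdDiff e (fwdDiff e p) = 0 := by
      apply ih (hp e)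
      rw [fwdDiff_fwdDiff_comm, h]
      funext n; simp [fwdDiff]
    funext n
    have h2 : ∀ n, fwdDiff e p (n + e) = fwdDiff e p n := fun n => sub_eq_zero.1 (congrFun h1 n)
    have h3 : ∀ k : ℤ, fwdDiff e p (n + k • e) = fwdDiff e p n := by
      intro k
      induction k using Int.induction_on with
      | zero => simp
      | succ k ih => rw [add_smul, one_smul, ← add_assoc, h2, ih]
      | pred k ih => rw [← h2, ← ih]; congr 1; rw [sub_smul]; simp [add_assoc]
    have h4 : ∀ k : ℤ, p (n + k • e) = p n + k • fwdDiff e p n := by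
      intro k
      induction k using Int.induction_on with
      | zero => simp
      | succ k ih =>
        have := h3 k
        rw [fwdDiff, sub_eq_iff_eq_add] at this
        rw [add_smul, one_smul, ← add_assoc, this, ih, add_smul, one_smul]
        abel
      | pred k ih =>
        have := h3 (-k - 1)
        rw [fwdDiff, sub_eq_iff_eq_add] at this
        have h5 : n + (-(k : ℤ) - 1) • e + e = n + (-(k : ℤ)) • e := by
          rw [sub_smul]; simp [add_assoc]
        rw [h5, ih] at this
        rw [eq_sub_of_add_eq' this.symm, sub_smul, one_smul, add_sub]
    have h6 := congrFun h n
    rw [fwdDiff, h4, add_sub_cancel_left] at h6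
    exact (smul_eq_zero_iff_right hj).1 h6

/-- If the difference of `p` with step `e` is not constant, then neither is its difference with step
a nonzero multiple of `e`. -/
theorem exists_fwdDiff_zsmul_ne [IsAddTorsionFree A] {d : ℕ} {p : G → A}
    (hp : FwdDiffDegreeLE (d + 1) p) {e : G} {j : ℤ} (hj : j ≠ 0)
    (he : ∃ g, fwdDiff g (fwdDiff e p) ≠ 0) : ∃ g, fwdDiff g (fwdDiff (j • e) p) ≠ 0 := by
  obtain ⟨g, hg⟩ := he
  refine ⟨g, fun h => hg ?_⟩
  rw [fwdDiff_fwdDiff_comm] at h ⊢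
  exact fwdDiff_eq_zero_of_zsmul (hp g) hj h

end FwdDiffDegreeLE

end FwdDiff

theorem IsIntegralPolynomial.exists_fwdDiffDegreeLE {m : ℕ} {p : (Fin m → ℤ) → ℤ}
    (hp : IsIntegralPolynomial p) : ∃ d, FwdDiffDegreeLE d p := by
  obtain ⟨P, hP⟩ := hp
  suffices h : ∃ d, FwdDiffDegreeLE d
      (fun n : Fin m → ℤ => MvPolynomial.eval (fun i => (n i : ℚ)) P) by
    obtain ⟨d, hd⟩ := h
    simp only [hP] at hd
    exact ⟨d, .of_comp_injective (Int.castAddHom ℚ) Int.cast_injective hd⟩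
  clear hP
  induction P using MvPolynomial.induction_on with
  | C a => exact ⟨0, fun h => by funext n; simp [fwdDiff]⟩
  | add P Q hP hQ =>
    obtain ⟨d, hd⟩ := hP
    obtain ⟨e, he⟩ := hQ
    refine ⟨max d e, ?_⟩
    simp only [map_add]
    exact (hd.mono (le_max_left d e)).add (he.mono (le_max_right d e))
  | mul_X P i hP =>
    obtain ⟨d, hd⟩ := hP
    refine ⟨d + 1, ?_⟩
    simp only [map_mul, MvPolynomial.eval_X]
    exact hd.mul_addMonoidHom ((Int.castAddHom ℚ).comp (Pi.evalAddMonoidHom (fun _ => ℤ) i))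

/-! ### Averages along Følner sequences -/

/-- The average of `u` over the finite set `s`; it is `0` when `s` is empty. -/
noncomputable def finsetAvg {G E : Type*} [AddCommGroup E] [Module ℝ E]
    (s : Finset G) (u : G → E) : E :=
  (s.card : ℝ)⁻¹ • ∑ n ∈ s, u n

section FinsetAvg

theorem norm_sum_sub_sum_le {G E : Type*} [NormedAddCommGroup E] [DecidableEq G] (s t : Finset G) (u : G → E) {C : ℝ}
    (hu : ∀ n, ‖u n‖ ≤ C) :
    ‖∑ n ∈ s, u n - ∑ n ∈ t, u n‖ ≤ C * (symmDiff s t).card := by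
  rw [← Finset.sum_sdiff_sub_sum_sdiff]
  have h : (symmDiff s t).card = (s \ t).card + (t \ s).card := by
    rw [symmDiff_def, Finset.sup_eq_union, Finset.card_union_of_disjoint disjoint_sdiff_sdiff]
  have h1 : ∀ r : Finset G, ‖∑ n ∈ r, u n‖ ≤ C * r.card := by
    intro r
    refine (norm_sum_le _ _).trans ?_
    have := Finset.sum_le_card_nsmul r (fun n => ‖u n‖) C fun n _ => hu n
    rwa [nsmul_eq_mul, mul_comm] at this
  refine (norm_sub_le _ _).trans ?_
  rw [h, Nat.cast_add, mul_add]
  exact add_le_add (h1 _) (h1 _)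

variable {G E : Type*} [NormedAddCommGroup E] [InnerProductSpace ℝ E]

theorem finsetAvg_smul_sum {ι : Type*} (s : Finset G) (t : Finset ι) (c : ℝ) (u : ι → G → E) :
    finsetAvg s (fun n => c • ∑ j ∈ t, u j n) = c • ∑ j ∈ t, finsetAvg s (u j) := by
  simp only [finsetAvg, ← Finset.smul_sum]
  rw [smul_comm, Finset.sum_comm]

theorem finsetAvg_le_of_forall_le {s : Finset G} {u : G → ℝ} {c : ℝ} (hc : 0 ≤ c)
    (h : ∀ n, u n ≤ c) : finsetAvg s u ≤ c := by
  rcases s.eq_empty_or_nonempty with rfl | hs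
  · simpa [finsetAvg] using hc
  · have hs' : (0 : ℝ) < s.card := by exact_mod_cast hs.card_pos
    rw [finsetAvg, smul_eq_mul, inv_mul_le_iff₀ hs']
    simpa using Finset.sum_le_card_nsmul s u c fun n _ => h n

theorem norm_finsetAvg_sq_le (s : Finset G) (u : G → E) :
    ‖finsetAvg s u‖ ^ 2 ≤ finsetAvg s (fun n => ‖u n‖ ^ 2) := by
  rcases s.eq_empty_or_nonempty with rfl | hs
  · simp [finsetAvg]
  · have hs' : (0 : ℝ) < s.card := by exact_mod_cast hs.card_pos
    have h1 : ‖∑ n ∈ s, u n‖ ^ 2 ≤ s.card * ∑ n ∈ s, ‖u n‖ ^ 2 :=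
      (pow_le_pow_left₀ (norm_nonneg _) (norm_sum_le _ _) 2).trans sq_sum_le_card_mul_sum_sq
    rw [finsetAvg, finsetAvg, norm_smul, mul_pow, norm_inv, Real.norm_natCast, smul_eq_mul]
    calc ((s.card : ℝ)⁻¹) ^ 2 * ‖∑ n ∈ s, u n‖ ^ 2
        ≤ ((s.card : ℝ)⁻¹) ^ 2 * (s.card * ∑ n ∈ s, ‖u n‖ ^ 2) := by gcongr
      _ = (s.card : ℝ)⁻¹ * ∑ n ∈ s, ‖u n‖ ^ 2 := by field_simp

end FinsetAvg

section Foelner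

open scoped Pointwise

variable {m : ℕ} {Φ : ℕ → Finset (Fin m → ℤ)} {E : Type*} [NormedAddCommGroup E]
  [InnerProductSpace ℝ E]

theorem IsFoelnerSeq.eventually_nonempty (hΦ : IsFoelnerSeq Φ) : ∀ᶠ N in atTop, (Φ N).Nonempty := by
  filter_upwards [IsAddFoelner.eventually_meas_ne_zero hΦ] with N hN
  rw [Finset.nonempty_iff_ne_empty]
  rintro h
  simp [h] at hN

theorem IsFoelnerSeq.tendsto_card_symmDiff (hΦ : IsFoelnerSeq Φ) (g : Fin m → ℤ) :
    Tendsto (fun N => ((Φ N).card : ℝ)⁻¹ *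
      (symmDiff ((Φ N).map (addRightEmbedding g)) (Φ N)).card) atTop (𝓝 0) := by
  have h := (ENNReal.tendsto_toReal ENNReal.zero_ne_top).comp
    (IsAddFoelner.tendsto_meas_vadd_symmDiff hΦ g)
  rw [ENNReal.toReal_zero] at h
  refine h.congr fun N => ?_
  have h1 : symmDiff (g +ᵥ (Φ N : Set (Fin m → ℤ)) : Set (Fin m → ℤ)) (Φ N) =
      (symmDiff ((Φ N).map (addRightEmbedding g)) (Φ N) : Finset _) := by
    rw [Finset.coe_symmDiff]
    congr 1
    ext x
    simp only [Set.mem_vadd_set, Finset.mem_coe, vadd_eq_add, Finset.mem_map,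
      addRightEmbedding_apply, add_comm]
  simp only [Function.comp_apply]
  rw [h1, Measure.count_apply_finset, Measure.count_apply_finset, ENNReal.toReal_div]
  simp [div_eq_inv_mul]

/-- Averages of bounded functions along a Følner sequence are asymptotically invariant under
translation. -/
theorem IsFoelnerSeq.tendsto_finsetAvg_shift_sub (hΦ : IsFoelnerSeq Φ) {u : (Fin m → ℤ) → E} {C : ℝ}
    (hu : ∀ n, ‖u n‖ ≤ C) (g : Fin m → ℤ) :
    Tendsto (fun N => finsetAvg (Φ N) (fun n => u (n + g)) - finsetAvg (Φ N) u) atTop (𝓝 0) := by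
  have h := (hΦ.tendsto_card_symmDiff g).const_mul C
  rw [mul_zero] at h
  refine squeeze_zero_norm (fun N => ?_) h
  have h1 : ∑ n ∈ Φ N, u (n + g) = ∑ n ∈ (Φ N).map (addRightEmbedding g), u n := by simp
  rw [finsetAvg, finsetAvg, ← smul_sub, norm_smul, h1, norm_inv, Real.norm_natCast, mul_left_comm]
  gcongr
  exact norm_sum_sub_sum_le _ _ u hu

/-- A form of van der Corput's inequality: the averages of `u` tend to zero as soon as the mean
squares of the short averages of `u` in a fixed direction `g` can be made arbitrarily small. -/
theorem IsFoelnerSeq.tendsto_finsetAvg_zero_of_short (hΦ : IsFoelnerSeq Φ) {u : (Fin m → ℤ) → E}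
    {C : ℝ} (hu : ∀ n, ‖u n‖ ≤ C) (g : Fin m → ℤ)
    (h : ∀ ε > 0, ∃ H : ℕ, 0 < H ∧ ∀ᶠ N in atTop, finsetAvg (Φ N)
      (fun n => ‖(H : ℝ)⁻¹ • ∑ j ∈ Finset.range H, u (n + j • g)‖ ^ 2) ≤ ε) :
    Tendsto (fun N => finsetAvg (Φ N) u) atTop (𝓝 0) := by
  rw [Metric.tendsto_nhds]
  simp only [dist_zero_right]
  intro ε hε
  obtain ⟨H, hH, hN⟩ := h ((ε / 2) ^ 2) (by positivity)
  have hlim : Tendsto (fun N => finsetAvg (Φ N)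
      (fun n => (H : ℝ)⁻¹ • ∑ j ∈ Finset.range H, u (n + j • g)) - finsetAvg (Φ N) u)
      atTop (𝓝 0) := by
    have h1 := (tendsto_finsetSum (Finset.range H) fun j _ =>
      hΦ.tendsto_finsetAvg_shift_sub hu (j • g)).const_smul (H : ℝ)⁻¹
    simp only [Finset.sum_const_zero, smul_zero] at h1
    refine h1.congr fun N => ?_
    have hH' : (H : ℝ) ≠ 0 := by exact_mod_cast hH.ne'
    rw [finsetAvg_smul_sum, Finset.sum_sub_distrib, smul_sub, Finset.sum_const, Finset.card_range,
      ← Nat.cast_smul_eq_nsmul ℝ, smul_smul, inv_mul_cancel₀ hH', one_smul]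
  filter_upwards [hN, (tendsto_zero_iff_norm_tendsto_zero.1 hlim).eventually_lt_const
    (half_pos hε)] with N h1 h2
  have h3 := abs_le_of_sq_le_sq ((norm_finsetAvg_sq_le _ _).trans h1) (half_pos hε).le
  have h4 := norm_sub_norm_le (finsetAvg (Φ N) u) (finsetAvg (Φ N)
      (fun n => (H : ℝ)⁻¹ • ∑ j ∈ Finset.range H, u (n + j • g)))
  rw [norm_sub_rev] at h4
  linarith [le_abs_self ‖finsetAvg (Φ N)
    (fun n => (H : ℝ)⁻¹ • ∑ j ∈ Finset.range H, u (n + j • g))‖, abs_le.1 h3]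

/-- Van der Corput's lemma: the averages of `u` tend to zero if the correlations of `u` with its
translates along multiples of a fixed direction `g` average to zero. -/
theorem IsFoelnerSeq.tendsto_finsetAvg_zero_of_correlation (hΦ : IsFoelnerSeq Φ)
    {u : (Fin m → ℤ) → E} {C : ℝ} (hu : ∀ n, ‖u n‖ ≤ C) (g : Fin m → ℤ)
    (h : ∀ i j : ℕ, i ≠ j → Tendsto (fun N => finsetAvg (Φ N)
      (fun n => inner ℝ (u (n + i • g)) (u (n + j • g)))) atTop (𝓝 0)) :
    Tendsto (fun N => finsetAvg (Φ N) u) atTop (𝓝 0) := by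
  refine hΦ.tendsto_finsetAvg_zero_of_short hu g fun ε hε => ?_
  -- The `H` diagonal terms contribute at most `C ^ 2 / H`, the others tend to zero.
  obtain ⟨H, hH⟩ := exists_nat_gt (C ^ 2 / (ε / 2))
  have hH0 : (0 : ℝ) < H := lt_of_le_of_lt (by positivity) hH
  refine ⟨H, by exact_mod_cast hH0, ?_⟩
  have hexp : ∀ N, finsetAvg (Φ N)
      (fun n => ‖(H : ℝ)⁻¹ • ∑ j ∈ Finset.range H, u (n + j • g)‖ ^ 2) =
      ((H : ℝ)⁻¹ ^ 2) • ∑ x ∈ Finset.range H ×ˢ Finset.range H, finsetAvg (Φ N)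
        (fun n => inner ℝ (u (n + x.1 • g)) (u (n + x.2 • g))) := by
    intro N
    rw [← finsetAvg_smul_sum]
    congr 1
    funext n
    rw [norm_smul, mul_pow, norm_inv, Real.norm_natCast, ← real_inner_self_eq_norm_sq, sum_inner,
      Finset.sum_product, smul_eq_mul]
    simp only [inner_sum]
  have hoff : Tendsto (fun N => ((H : ℝ)⁻¹ ^ 2) •
      ∑ x ∈ (Finset.range H).offDiag, finsetAvg (Φ N)
        (fun n => inner ℝ (u (n + x.1 • g)) (u (n + x.2 • g)))) atTop (𝓝 0) := by
    have := (tendsto_finsetSum (Finset.range H).offDiag fun x hx =>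
      h x.1 x.2 (Finset.mem_offDiag.1 hx).2.2).const_smul ((H : ℝ)⁻¹ ^ 2)
    simpa using this
  filter_upwards [hoff.eventually_lt_const (half_pos hε)] with N hN
  rw [hexp, ← Finset.diag_union_offDiag, Finset.sum_union (Finset.disjoint_diag_offDiag _),
    smul_add]
  have hdiag : ((H : ℝ)⁻¹ ^ 2) • ∑ x ∈ (Finset.range H).diag, finsetAvg (Φ N)
        (fun n => inner ℝ (u (n + x.1 • g)) (u (n + x.2 • g))) ≤ ε / 2 := by
    have h1 : ∑ x ∈ (Finset.range H).diag, finsetAvg (Φ N)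
        (fun n => inner ℝ (u (n + x.1 • g)) (u (n + x.2 • g))) ≤ H * C ^ 2 := by
      have := Finset.sum_le_card_nsmul (Finset.range H).diag (fun x => finsetAvg (Φ N)
        (fun n => inner ℝ (u (n + x.1 • g)) (u (n + x.2 • g)))) (C ^ 2) ?_
      · simpa using this
      · intro x hx
        refine finsetAvg_le_of_forall_le (sq_nonneg C) fun n => ?_
        rw [(Finset.mem_diag.1 hx).2, real_inner_self_eq_norm_sq]
        exact pow_le_pow_left₀ (norm_nonneg _) (hu _) 2
    rw [smul_eq_mul]
    calc ((H : ℝ)⁻¹ ^ 2) * _ ≤ ((H : ℝ)⁻¹ ^ 2) * (H * C ^ 2) := by gcongr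
      _ = C ^ 2 / H := by field_simp
      _ ≤ ε / 2 := by
        rw [div_lt_iff₀ (half_pos hε)] at hH
        rw [div_le_iff₀ hH0]
        linarith
  linarith

end Foelner

/-! ### Polynomial averages of isometries -/

section Isometries

variable {m : ℕ} {Φ : ℕ → Finset (Fin m → ℤ)} {E : Type*} [NormedAddCommGroup E]
  [InnerProductSpace ℝ E]

/-- Let `ℤ` act on a real inner product space by isometries, and let `f` be a vector whose Cesàro
averages along every infinite progression `k ℕ` tend to zero. Then its averages along every
non-constant polynomial tend to zero in norm. Induction on the degree: if some difference of `p` is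
not constant, van der Corput's lemma in that direction reduces the claim to the differences of `p`;
otherwise `p` is affine and the short averages of `U (p n) f` are small by hypothesis. -/
theorem tendsto_finsetAvg_of_tendsto_cesaro (U : ℤ → E →ₗᵢ[ℝ] E)
    (hU : ∀ a b x, U (a + b) x = U a (U b x)) {f : E}
    (hf : ∀ k : ℤ, k ≠ 0 → Tendsto (fun H : ℕ => (H : ℝ)⁻¹ • ∑ j ∈ Finset.range H, U (j • k) f)
      atTop (𝓝 0))
    (hΦ : IsFoelnerSeq Φ) {d : ℕ} {p : (Fin m → ℤ) → ℤ} (hp : FwdDiffDegreeLE d p)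
    (hp' : ∃ g, fwdDiff g p ≠ 0) :
    Tendsto (fun N => finsetAvg (Φ N) (fun n => U (p n) f)) atTop (𝓝 0) := by
  have hbound : ∀ n, ‖U (p n) f‖ ≤ ‖f‖ := fun n => ((U (p n)).norm_map f).le
  induction d generalizing p with
  | zero => exact absurd (hp _) hp'.choose_spec
  | succ d ih =>
    by_cases hlin : ∃ e g, fwdDiff g (fwdDiff e p) ≠ 0
    · obtain ⟨e, he⟩ := hlin
      refine hΦ.tendsto_finsetAvg_zero_of_correlation hbound e fun i j hij => ?_
      have hij' : (i : ℤ) - j ≠ 0 := by omega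
      obtain ⟨g, hg⟩ := hp.exists_fwdDiff_zsmul_ne hij' he
      -- The difference of the two exponents is a translate of a difference of `p`.
      have hlim := ih (p := fun n => fwdDiff (((i : ℤ) - j) • e) p (n + j • e))
        ((hp _).shift _)
        ⟨g, fun h0 => hg <| by
          funext n
          have := congrFun h0 (n - j • e)
          simpa [fwdDiff, sub_add_eq_add_sub] using this⟩
        (fun n => ((U _).norm_map f).le)
      have h2 := ((innerSL ℝ f).continuous.tendsto _).comp hlim
      rw [map_zero] at h2
      refine h2.congr fun N => ?_
      simp only [Function.comp_apply, finsetAvg, map_smul, map_sum, innerSL_apply_apply]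
      congr 1
      refine Finset.sum_congr rfl fun n _ => ?_
      have h3 : p (n + i • e) = p (n + j • e) + fwdDiff (((i : ℤ) - j) • e) p (n + j • e) := by
        have : n + j • e + ((i : ℤ) - j) • e = n + i • e := by
          rw [sub_smul, natCast_zsmul, natCast_zsmul]; abel
        rw [fwdDiff, this]; ring
      rw [h3, hU, LinearIsometry.inner_map_map, real_inner_comm]
    · push Not at hlin
      obtain ⟨e, he⟩ := hp'
      obtain ⟨n₀, hn₀⟩ := Function.ne_iff.1 he
      have hstep : ∀ n, p (n + e) = p n + fwdDiff e p n₀ := by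
        intro n
        have := congrFun (hlin e (n - n₀)) n₀
        rw [fwdDiff, add_sub_cancel, Pi.zero_apply, sub_eq_zero] at this
        rw [← this, fwdDiff]; ring
      have hsteps : ∀ (j : ℕ) n, p (n + j • e) = p n + j • fwdDiff e p n₀ := by
        intro j n
        induction j with
        | zero => simp
        | succ j ih => rw [succ_nsmul, ← add_assoc, hstep, ih, succ_nsmul, add_assoc]
      refine hΦ.tendsto_finsetAvg_zero_of_short hbound e fun ε hε => ?_
      have h1 := ((hf _ hn₀).norm.pow 2).eventually_lt_const
        (show ‖(0 : E)‖ ^ 2 < ε by simpa using hε)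
      obtain ⟨H, hH, hH0⟩ := (h1.and (eventually_gt_atTop 0)).exists
      refine ⟨H, hH0, Eventually.of_forall fun N => finsetAvg_le_of_forall_le hε.le fun n => ?_⟩
      simp only [hsteps, hU, ← map_sum, ← map_smul, LinearIsometry.norm_map]
      exact hH.le

end Isometries

/-! ### Koopman operators of a totally ergodic transformation -/

section Koopman

variable {X : Type*} [MeasurableSpace X]

theorem zpowMap_zero (T : X ≃ᵐ X) : zpowMap T 0 = id := by
  funext x; simp [zpowMap]

theorem zpowMap_add (T : X ≃ᵐ X) (a b : ℤ) : zpowMap T (a + b) = zpowMap T a ∘ zpowMap T b := by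
  funext x; simp [zpowMap, zpow_add]

theorem IsTotallyErgodic.measurePreserving {μ : Measure X} {T : X ≃ᵐ X}
    (hT : IsTotallyErgodic T μ) (k : ℤ) : MeasurePreserving (zpowMap T k) μ μ := by
  rcases eq_or_ne k 0 with rfl | hk
  · rw [zpowMap_zero]; exact .id μ
  · exact (hT k hk).toMeasurePreserving

/-- The Koopman operator `g ↦ g ∘ f` of a measure preserving map `f` on real `L²`. -/
noncomputable def koopman {μ : Measure X} (f : X → X) (hf : MeasurePreserving f μ μ) :
    Lp ℝ 2 μ →ₗᵢ[ℝ] Lp ℝ 2 μ :=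
  Lp.compMeasurePreservingₗᵢ ℝ f hf

theorem koopman_zpowMap_add {μ : Measure X} {T : X ≃ᵐ X} (hT : IsTotallyErgodic T μ) (a b : ℤ)
    (g : Lp ℝ 2 μ) : koopman _ (hT.measurePreserving (a + b)) g =
      koopman _ (hT.measurePreserving a) (koopman _ (hT.measurePreserving b) g) := by
  have h := Lp.compMeasurePreserving_comp_apply g (hT.measurePreserving b) (hT.measurePreserving a)
  have h1 : zpowMap T (a + b) = zpowMap T b ∘ zpowMap T a := by rw [add_comm, zpowMap_add]
  have h2 : ∀ (F : X → X) (hF : MeasurePreserving F μ μ), F = zpowMap T b ∘ zpowMap T a →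
      Lp.compMeasurePreserving F hF g = Lp.compMeasurePreserving (zpowMap T b ∘ zpowMap T a)
        ((hT.measurePreserving b).comp (hT.measurePreserving a)) g := by
    rintro F hF rfl; rfl
  exact (h2 _ (hT.measurePreserving (a + b)) h1).trans h

theorem koopman_zpowMap_nsmul {μ : Measure X} {T : X ≃ᵐ X} (hT : IsTotallyErgodic T μ) (k : ℤ)
    (j : ℕ) (g : Lp ℝ 2 μ) : koopman _ (hT.measurePreserving (j • k)) g =
      (koopman _ (hT.measurePreserving k))^[j] g := by
  induction j with
  | zero =>
    have h2 : ∀ (F : X → X) (hF : MeasurePreserving F μ μ), F = id → koopman F hF g = g := by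
      rintro F hF rfl; exact Lp.compMeasurePreserving_id_apply g
    exact h2 _ _ (by rw [zero_smul, zpowMap_zero])
  | succ j ih =>
    have h : (j + 1) • k = k + j • k := by rw [succ_nsmul, add_comm]
    rw [Function.iterate_succ_apply', ← ih, ← koopman_zpowMap_add hT]
    congr 3

/-- The mean ergodic theorem for an ergodic map on the orthogonal complement of the constants. -/
theorem Ergodic.tendsto_birkhoffAverage_koopman_zero {μ : Measure X} [IsProbabilityMeasure μ]
    {F : X → X} (hF : Ergodic F μ) {f : Lp ℝ 2 μ} (hf : inner ℝ (Lp.const 2 μ (1 : ℝ)) f = 0) :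
    Tendsto (fun H : ℕ => (H : ℝ)⁻¹ • ∑ j ∈ Finset.range H,
      (koopman F hF.toMeasurePreserving)^[j] f) atTop (𝓝 0) := by
  set K := (koopman F hF.toMeasurePreserving).toContinuousLinearMap
  have h := K.tendsto_birkhoffAverage_orthogonalProjection
    (LinearIsometry.norm_toContinuousLinearMap_le _) f
  have h0 : (K.eqLocus (1 : Lp ℝ 2 μ →L[ℝ] Lp ℝ 2 μ)).orthogonalProjectionOnto f = 0 := by
    rw [Submodule.orthogonalProjectionOnto_eq_zero_iff, Submodule.mem_orthogonal]
    intro g hg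
    obtain ⟨c, hc⟩ := hF.eq_const_of_compMeasurePreserving_eq (g := g.1) (congrArg Subtype.val hg)
    have hc' : g = c • Lp.const 2 μ (1 : ℝ) := by
      have h1 : g = Lp.const 2 μ c := Subtype.ext hc
      have h2 := map_smul (Lp.constₗ 2 μ ℝ) c (1 : ℝ)
      rw [smul_eq_mul, mul_one] at h2
      exact h1.trans h2
    rw [hc', real_inner_smul_left, hf, mul_zero]
  rw [h0] at h
  exact h

theorem IsTotallyErgodic.tendsto_cesaro_koopman_zero {μ : Measure X} [IsProbabilityMeasure μ]
    {T : X ≃ᵐ X} (hT : IsTotallyErgodic T μ) {f : Lp ℝ 2 μ}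
    (hf : inner ℝ (Lp.const 2 μ (1 : ℝ)) f = 0) {k : ℤ} (hk : k ≠ 0) :
    Tendsto (fun H : ℕ => (H : ℝ)⁻¹ • ∑ j ∈ Finset.range H,
      koopman _ (hT.measurePreserving (j • k)) f) atTop (𝓝 0) := by
  refine ((hT k hk).tendsto_birkhoffAverage_koopman_zero hf).congr fun H => ?_
  congr 1
  exact Finset.sum_congr rfl fun j _ => (koopman_zpowMap_nsmul hT k j f).symm

end Koopman

/-! ### The limit of the return measures -/

theorem proposition6p2 {X : Type*} [MeasurableSpace X] (μ : Measure X) [IsProbabilityMeasure μ]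
    (T : X ≃ᵐ X) (hT : IsTotallyErgodic T μ)
    {m : ℕ} (p : (Fin m → ℤ) → ℤ) (hp : IsIntegralPolynomial p)
    (hp_nonconst : ∃ n n' : Fin m → ℤ, p n ≠ p n')
    (A : Set X) (hA : MeasurableSet A) :
    HasUCLim (fun n => μ.real (A ∩ zpowMap T (p n) ⁻¹' A)) (μ.real A ^ 2) := by
  intro Φ hΦ
  obtain ⟨d, hd⟩ := hp.exists_fwdDiffDegreeLE
  have hp' : ∃ g, fwdDiff g p ≠ 0 := by
    obtain ⟨n, n', h⟩ := hp_nonconst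
    refine ⟨n - n', fun h0 => h ?_⟩
    have := congrFun h0 n'
    rwa [fwdDiff, add_sub_cancel, Pi.zero_apply, sub_eq_zero] at this
  set U : ℤ → Lp ℝ 2 μ →ₗᵢ[ℝ] Lp ℝ 2 μ := fun k => koopman _ (hT.measurePreserving k) with hUdef
  set a : Lp ℝ 2 μ := indicatorConstLp 2 hA (measure_ne_top μ A) 1 with ha
  set one : Lp ℝ 2 μ := indicatorConstLp 2 .univ (measure_ne_top μ _) 1 with hone
  set f : Lp ℝ 2 μ := a - μ.real A • one with hfdef
  have hUone : ∀ k, U k one = one := fun k =>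
    Lp.indicatorConstLp_compMeasurePreserving .univ _ _ (hT.measurePreserving k)
  have hinner : ∀ k, inner ℝ a (U k a) = μ.real (A ∩ zpowMap T k ⁻¹' A) := fun k => by
    have h1 : U k a = _ :=
      Lp.indicatorConstLp_compMeasurePreserving hA (measure_ne_top μ A) (1 : ℝ)
        (hT.measurePreserving k)
    rw [h1, ha, L2.inner_indicatorConstLp_indicatorConstLp]
    simp
  have hone_a : inner ℝ one a = μ.real A := by
    rw [hone, ha, L2.inner_indicatorConstLp_indicatorConstLp]
    simp
  have hone_one : inner ℝ one one = 1 := by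
    rw [hone, L2.inner_indicatorConstLp_indicatorConstLp]
    simp
  have hf0 : inner ℝ (Lp.const 2 μ (1 : ℝ)) f = 0 := by
    rw [← indicatorConstLp_univ, hfdef, inner_sub_right, real_inner_smul_right, ← hone, hone_a,
      hone_one, mul_one, sub_self]
  have hlim := tendsto_finsetAvg_of_tendsto_cesaro U (koopman_zpowMap_add hT) (f := f)
    (fun k hk => hT.tendsto_cesaro_koopman_zero hf0 hk) hΦ hd hp'
  have h2 := (((innerSL ℝ a).continuous.tendsto _).comp hlim).add_const (μ.real A ^ 2)
  rw [map_zero, zero_add] at h2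
  refine h2.congr' ?_
  filter_upwards [hΦ.eventually_nonempty] with N hN
  have hN' : ((Φ N).card : ℝ) ≠ 0 := by exact_mod_cast hN.card_pos.ne'
  have h3 : ∀ n, inner ℝ a (U (p n) f) =
      μ.real (A ∩ zpowMap T (p n) ⁻¹' A) - μ.real A ^ 2 := fun n => by
    rw [hfdef, map_sub, map_smul, hUone, inner_sub_right, real_inner_smul_right, hinner,
      real_inner_comm, hone_a, sq]
  simp only [Function.comp_apply, finsetAvg, map_smul, map_sum, innerSL_apply_apply, h3,
    Finset.sum_sub_distrib, Finset.sum_const, smul_eq_mul, nsmul_eq_mul]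
  field_simp
  ring
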